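/- Let $g_1,\dots,g_m\in\mathbb R[x]=\mathbb R[x_1,\dots,x_n]$, let $r>0$, let $\mathcal B_r=\{x\in\mathbb R^n:\|x\|\le r\}$ (Euclidean norm), and let $U_j>0$ satisfy $U_j\ge\max\{g_j(x):x\in\mathcal B_r\}$ for $j=1,\dots,m$. Let $p\in\mathbb R[x]$ satisfy $p(x)>0$ for all $x\in\mathcal B_r$ with $g_1(x)\ge0,\dots,g_m(x)\ge0$. Write $e=(1,\dots,1)\in\mathbb R^n$. The following classes of real polynomials, in any finite number $N$ of variables, are used; all sums are finite and may be empty. * SDSOS: sums of squares of the form $(a x^{\alpha}+b x^{\beta})^2$ with $a,b\in\mathbb R$, $\alpha,\beta\in\mathbb N^N$. DSOS: such sums in which every summand has $a=b$ or $a=-b$. * SONC: sums of circuit polynomials that are non-negative on $\mathbb R^N$. A circuit polynomial is a polynomial $\sum_{\alpha\in A}c_\alpha x^\alpha-d x^\beta$ with $d\in\mathbb R$, $c_\alpha>0$ for all $\alpha\in A$, where $A\subseteq(2\mathbb N)^N$ is the vertex set of a simplex (possibly a single point) and $\beta\in\mathbb N^N$ lies in the relative interior of this simplex. * SAGE: sums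 of AGE polynomials. An AGE polynomial is a polynomial that is non-negative on the non-negative orthant $\mathbb R^N_+$ and has at most one negative coefficient. Then: (i) For $\mathcal K$ equal to each of the classes of SONC, SDSOS, DSOS and SAGE polynomials, there exist polynomials $\alpha_0(y,z,u),\alpha_1(y,z,u)\in\mathcal K$ in the $2n+1$ variables $y=(y_1,\dots,y_n)$, $z=(z_1,\dots,z_n)$, $u$, and univariate polynomials $\rho_1(u),\dots,\rho_m(u)\in\mathcal K$ such that, as polynomials in $x$, $$p(x)=\alpha_0(x+re,\,re-x,\,r^2-\|x\|^2)+\alpha_1(x+re,\,re-x,\,r^2-\|x\|^2)\,(r^2-\|x\|^2)+\sum_{j=1}^m\rho_j(U_j-g_j(x))\,g_j(x).$$ (ii) There exist a SAGE polynomial $\alpha(y,z,u)$ in $2n+1$ variables and univariate SAGE polynomials $\rho_1(u),\dots,\rho_m(u)$ such that $$p(x)=\alpha(x+re,\,re-x,\,r^2-\|x\|^2)+\sum_{j=1}^m\rho_j(U_j-g_j(x))\,g_j(x).$$ -/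

import Mathlib

open MvPolynomial

/-- `p` is a finite sum (possibly empty) of polynomials satisfying `P`. -/
def IsSumOf {σ : Type} (P : MvPolynomial σ ℝ → Prop) (p : MvPolynomial σ ℝ) : Prop :=
  ∃ (s : ℕ) (q : Fin s → MvPolynomial σ ℝ), (∀ l, P (q l)) ∧ p = ∑ l, q l

/-- SDSOS polynomials: sums of squares of binomials `a x^α + b x^β`. -/
def KSDSOS (σ : Type) : Set (MvPolynomial σ ℝ) :=
  {p | IsSumOf (fun q => ∃ (a b : ℝ) (α β : σ →₀ ℕ),
    q = (monomial α a + monomial β b) ^ 2) p}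

/-- DSOS polynomials: sums of squares of binomials `a x^α + b x^β` with `a = b` or `a = -b`. -/
def KDSOS (σ : Type) : Set (MvPolynomial σ ℝ) :=
  {p | IsSumOf (fun q => ∃ (a b : ℝ) (α β : σ →₀ ℕ),
    (a = b ∨ a = -b) ∧ q = (monomial α a + monomial β b) ^ 2) p}

/-- An exponent vector seen as a point of real space. -/
def exponentPoint {σ : Type} (α : σ →₀ ℕ) : σ → ℝ := fun i => (α i : ℝ)

/-- Circuit polynomials `∑_{α ∈ A} c_α x^α - d x^β`: the set `A` consists of even exponents and is
the vertex set of a simplex (its points are affinely independent), every `c_α` is positive, and `β`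
lies in the relative interior of that simplex. The coefficient `d` is any real number. A simplex
may be a single point, whose relative interior is that point. -/
def IsCircuitPolynomial {σ : Type} (p : MvPolynomial σ ℝ) : Prop :=
  ∃ (A : Finset (σ →₀ ℕ)) (c : (σ →₀ ℕ) → ℝ) (d : ℝ) (β : σ →₀ ℕ),
    (∀ α ∈ A, ∀ i, Even (α i)) ∧
    (∀ α ∈ A, 0 < c α) ∧
    AffineIndependent ℝ (fun α : A => exponentPoint (α : σ →₀ ℕ)) ∧
    exponentPoint β ∈ intrinsicInterior ℝ (convexHull ℝ (exponentPoint '' (A : Set (σ →₀ ℕ)))) ∧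
    p = ∑ α ∈ A, monomial α (c α) - monomial β d

/-- SONC polynomials: sums of circuit polynomials that are non-negative everywhere. -/
def KSONC (σ : Type) : Set (MvPolynomial σ ℝ) :=
  {p | IsSumOf (fun q => IsCircuitPolynomial q ∧ ∀ x : σ → ℝ, 0 ≤ eval x q) p}

/-- AGE polynomials: non-negative on the non-negative orthant, at most one negative coefficient. -/
def IsAGE {σ : Type} (q : MvPolynomial σ ℝ) : Prop :=
  (∀ x : σ → ℝ, (∀ i, 0 ≤ x i) → 0 ≤ eval x q) ∧ {α : σ →₀ ℕ | coeff α q < 0}.Subsingleton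

/-- SAGE polynomials: sums of AGE polynomials. -/
def KSAGE (σ : Type) : Set (MvPolynomial σ ℝ) :=
  {p | IsSumOf IsAGE p}

/-- The index type of the `2n+1` variables `(y, z, u)`, with `y = (y_1, …, y_n)`,
`z = (z_1, …, z_n)` and a single `u`. -/
abbrev YZU (n : ℕ) : Type := Fin n ⊕ Fin n ⊕ Unit

/-- The polynomial `r² - ‖x‖²` in `n` variables. -/
noncomputable def ballPoly (n : ℕ) (r : ℝ) : MvPolynomial (Fin n) ℝ :=
  C (r ^ 2) - ∑ i, X i ^ 2

/-- The polynomial `α(x + r e, r e - x, r² - ‖x‖²)` in the `n` variables `x`. -/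
noncomputable def substBall {n : ℕ} (r : ℝ) (α : MvPolynomial (YZU n) ℝ) :
    MvPolynomial (Fin n) ℝ :=
  aeval (Sum.elim (fun i => X i + C r)
    (Sum.elim (fun i => C r - X i) (fun _ => ballPoly n r))) α

/-- The polynomial `ρ(h(x))` for a univariate polynomial `ρ`. -/
noncomputable def substUniv {n : ℕ} (h : MvPolynomial (Fin n) ℝ) (ρ : MvPolynomial Unit ℝ) :
    MvPolynomial (Fin n) ℝ :=
  aeval (fun _ => h) ρ

/-! Damping reduces the claim to strict positivity on the whole ball. With `ρ j` equal to `(u / U j)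
^ (2 * k)` and `k` large, the subtracted terms are uniformly small where `g j ≥ 0` and very negative
where `g j < 0`, so `q = p - ∑ ρ j (U j - g j) * g j` is positive on the ball (`exists_damped_pos`).
The semiring generated by the non-negative constants, the squares of `x_i + r` and `r - x_i`, and
`r² - ‖x‖²` is archimedean, and its non-negative characters are evaluations at points of the ball.
The Krivine–Kadison–Dubois theorem (`mem_of_forall_character_pos`) therefore puts `q` in it. Its
elements have the form `α₀ + α₁ * (r² - ‖x‖²)`, where `α₀` and `α₁` have only even monomials with
positive coefficients; such polynomials belong to all four classes. -/

/-! ### Representation theorem for archimedean semirings -/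

section Representation

variable {A : Type*} [CommRing A] [Algebra ℝ A]

/-- The normalized linear functionals that are non-negative on `T`, as a set of functions. -/
def stateSet (T : Subsemiring A) : Set (A → ℝ) :=
  {L | (∀ f g, L (f + g) = L f + L g) ∧ (∀ (c : ℝ) f, L (c • f) = c * L f) ∧
    (∀ t ∈ T, 0 ≤ L t) ∧ L 1 = 1}

variable {T : Subsemiring A}

theorem stateSet_sub {L : A → ℝ} (hL : L ∈ stateSet T) (f g : A) : L (f - g) = L f - L g := by
  have := hL.1 (f - g) g
  rw [sub_add_cancel] at this
  linarith

theorem stateSet_algebraMap {L : A → ℝ} (hL : L ∈ stateSet T) (c : ℝ) :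
    L (algebraMap ℝ A c) = c := by
  rw [Algebra.algebraMap_eq_smul_one, hL.2.1, hL.2.2.2, mul_one]

/-- Tychonoff: the archimedean bounds confine each value `L f` to a fixed interval, and the defining
conditions are closed under pointwise convergence. -/
theorem isCompact_stateSet (harch : ∀ f, ∃ N : ℝ, algebraMap ℝ A N - f ∈ T) :
    IsCompact (stateSet T) := by
  choose N hN using harch
  have hclosed : IsClosed (stateSet T) := by
    simp only [stateSet, Set.ofPred_and, Set.ofPred_forall]
    refine IsClosed.inter ?_ (IsClosed.inter ?_ (IsClosed.inter ?_ ?_))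
    · exact isClosed_iInter fun f => isClosed_iInter fun g =>
        isClosed_eq (by fun_prop) (by fun_prop)
    · exact isClosed_iInter fun c => isClosed_iInter fun f =>
        isClosed_eq (by fun_prop) (by fun_prop)
    · exact isClosed_iInter fun t => isClosed_iInter fun _ =>
        isClosed_le (by fun_prop) (by fun_prop)
    · exact isClosed_eq (by fun_prop) (by fun_prop)
  refine IsCompact.of_isClosed_subset
    (isCompact_univ_pi fun f : A => isCompact_Icc (a := -N (-f)) (b := N f)) hclosed ?_
  intro L hL f _
  have h1 := hL.2.2.1 _ (hN f)
  have h2 := hL.2.2.1 _ (hN (-f))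
  rw [stateSet_sub hL, stateSet_algebraMap hL] at h1 h2
  have h3 := stateSet_sub hL 0 f
  have h4 := stateSet_sub hL 0 0
  simp only [zero_sub, sub_self] at h3 h4
  constructor <;> linarith

/-- An element outside an archimedean semiring is separated from it by a state. -/
theorem exists_state_nonpos (hT : ∀ c : ℝ, 0 ≤ c → algebraMap ℝ A c ∈ T)
    (harch : ∀ f, ∃ N : ℝ, algebraMap ℝ A N - f ∈ T) {q : A} (hq : q ∉ T) :
    ∃ L ∈ stateSet T, L q ≤ 0 := by
  have hsmul : ∀ c : ℝ, 0 ≤ c → ∀ t ∈ T, c • t ∈ T := fun c hc t ht => by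
    rw [Algebra.smul_def]; exact T.mul_mem (hT c hc) ht
  let S : PointedCone ℝ A :=
    { carrier := {f | ∃ t ∈ T, ∃ c : ℝ, 0 ≤ c ∧ f = t - c • q}
      add_mem' := by
        rintro _ _ ⟨t, ht, c, hc, rfl⟩ ⟨t', ht', c', hc', rfl⟩
        exact ⟨t + t', T.add_mem ht ht', c + c', add_nonneg hc hc', by rw [add_smul]; abel⟩
      zero_mem' := ⟨0, T.zero_mem, 0, le_rfl, by simp⟩
      smul_mem' := by
        rintro ⟨a, ha⟩ _ ⟨t, ht, c, hc, rfl⟩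
        refine ⟨a • t, hsmul a ha t ht, a * c, mul_nonneg ha hc, ?_⟩
        change a • (t - c • q) = _
        rw [smul_sub, mul_smul] }
  have hTS : ∀ t ∈ T, t ∈ S := fun t ht => ⟨t, ht, 0, le_rfl, by simp⟩
  have hneg : (-1 : A) ∉ S := by
    rintro ⟨t, ht, c, hc, h⟩
    rcases hc.eq_or_lt with rfl | hc
    -- If `-1 ∈ T`, then all real constants lie in `T`, and `q = (N + q) - N` would too.
    · obtain ⟨N, hN⟩ := harch (-q)
      rw [zero_smul, sub_zero] at h
      apply hq
      have hmem : |N| • t ∈ T := hsmul _ (abs_nonneg N) t ht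
      have h2 : q = (algebraMap ℝ A N - -q) + |N| • t + algebraMap ℝ A (|N| - N) := by
        rw [← h, map_sub, smul_neg, ← Algebra.algebraMap_eq_smul_one]; abel
      rw [h2]
      exact T.add_mem (T.add_mem hN hmem) (hT _ (sub_nonneg.2 (le_abs_self N)))
    · apply hq
      have h2 : q = c⁻¹ • (t + 1) := by
        have : t + 1 = c • q := by linear_combination (norm := abel_nf) -h
        rw [this, smul_smul, inv_mul_cancel₀ hc.ne', one_smul]
      rw [h2]
      exact hsmul _ (inv_nonneg.2 hc.le) _ (T.add_mem ht T.one_mem)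
  have hone : (1 : A) ≠ 0 := by
    intro h
    apply hneg
    rw [h, neg_zero]
    exact S.zero_mem
  let f : A →ₗ.[ℝ] ℝ := LinearPMap.mkSpanSingleton' (1 : A) (1 : ℝ) (by
    intro c hc
    have : c = 0 := by simpa [hone] using hc
    simp [this])
  have hf : ∀ (c : ℝ) (h : c • (1 : A) ∈ f.domain), f ⟨c • (1 : A), h⟩ = c := fun c h => by
    refine (LinearPMap.mkSpanSingleton'_apply (σ := RingHom.id ℝ) (1 : A) (1 : ℝ) _ c h).trans ?_
    simp
  have hdom : ∀ c : ℝ, c • (1 : A) ∈ f.domain := fun c =>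
    Submodule.smul_mem _ _ (Submodule.mem_span_singleton_self _)
  obtain ⟨g, hg1, hg2⟩ := riesz_extension S f
    (by
      rintro ⟨x, hx⟩ hxS
      obtain ⟨c, rfl⟩ := Submodule.mem_span_singleton.1 hx
      rw [hf]
      by_contra! hc
      apply hneg
      have := S.smul_mem (inv_pos.2 (neg_pos.2 hc)).le hxS
      change (-c)⁻¹ • (c • (1 : A)) ∈ S at this
      rwa [smul_smul, inv_neg, neg_mul, inv_mul_cancel₀ hc.ne, neg_one_smul] at this)
    (by
      intro y
      obtain ⟨N, hN⟩ := harch (-y)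
      refine ⟨⟨N • 1, hdom N⟩, hTS _ ?_⟩
      rwa [sub_neg_eq_add, Algebra.algebraMap_eq_smul_one] at hN)
  refine ⟨g, ⟨map_add g, fun c f => map_smul g c f, fun t ht => hg2 t (hTS t ht), ?_⟩, ?_⟩
  · have := hg1 ⟨(1 : ℝ) • 1, hdom 1⟩
    rw [hf] at this
    simpa using this
  · have := hg2 (-q) ⟨0, T.zero_mem, 1, zero_le_one, by simp⟩
    rw [map_neg] at this
    linarith

/-- A state that is extreme is multiplicative by elements `a` with `0 ≤ a ≤ 1`. -/
theorem map_mul_of_extreme_of_le_one (harch : ∀ f, ∃ N : ℝ, algebraMap ℝ A N - f ∈ T)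
    {L : A → ℝ} (hL : L ∈ (stateSet T).extremePoints ℝ) {a : A} (ha : a ∈ T) (ha' : 1 - a ∈ T)
    (f : A) : L (a * f) = L a * L f := by
  have hLs := hL.1
  -- Apply `L` to `b * (N - f) ∈ T`, and then do the same with `-f`.
  have hzero : ∀ b ∈ T, L b = 0 → ∀ f, L (b * f) = 0 := by
    intro b hb hb0 f
    have key : ∀ f, L (b * f) ≤ 0 := by
      intro f
      obtain ⟨N, hN⟩ := harch f
      have := hLs.2.2.1 _ (T.mul_mem hb hN)
      rw [mul_sub, stateSet_sub hLs, mul_comm, ← Algebra.smul_def, hLs.2.1, hb0] at this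
      linarith
    have h1 := key f
    have h2 := key (-f)
    have h3 := stateSet_sub hLs 0 (b * f)
    have h4 := stateSet_sub hLs 0 0
    simp only [zero_sub, sub_self] at h3 h4
    rw [mul_neg] at h2
    linarith
  have hsub : ∀ f, L ((1 - a) * f) = L f - L (a * f) := fun f => by
    rw [sub_mul, one_mul, stateSet_sub hLs]
  have hL1a : L (1 - a) = 1 - L a := by rw [stateSet_sub hLs, hLs.2.2.2]
  rcases (hLs.2.2.1 a ha).eq_or_lt with h0 | h0
  · rw [hzero a ha h0.symm, ← h0, zero_mul]
  have hle := hLs.2.2.1 _ ha'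
  rcases hle.eq_or_lt with h1 | h1
  · have h2 := hzero _ ha' h1.symm f
    rw [hsub] at h2
    have : L a = 1 := by linarith
    rw [this]; linarith
  -- `L` is the convex combination, with weights `L a` and `L (1 - a)`, of the states `L (a * ·) / L
  -- a` and `L ((1 - a) * ·) / L (1 - a)`; extremality makes the first equal to `L`.
  have hmem : ∀ b ∈ T, 0 < L b → (fun f => (L b)⁻¹ * L (b * f)) ∈ stateSet T := by
    intro b hb hb0
    refine ⟨fun f g => ?_, fun c f => ?_, fun t ht => ?_, ?_⟩
    · simp only [mul_add, hLs.1]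
    · simp only [mul_smul_comm, hLs.2.1]; ring
    · exact mul_nonneg (inv_nonneg.2 hb0.le) (hLs.2.2.1 _ (T.mul_mem hb ht))
    · simp only [mul_one]; exact inv_mul_cancel₀ hb0.ne'
  have := (mem_extremePoints_iff_left.1 hL).2 _ (hmem a ha h0) _ (hmem _ ha' h1)
    ⟨L a, L (1 - a), h0, h1, by rw [hL1a]; ring, by
      funext f
      simp only [Pi.add_apply, Pi.smul_apply, smul_eq_mul]
      rw [mul_inv_cancel_left₀ h0.ne', mul_inv_cancel_left₀ h1.ne', hsub]; ring⟩
  have h2 := congrFun this f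
  rw [← h2, mul_inv_cancel_left₀ h0.ne']

theorem map_mul_of_extreme (hT : ∀ c : ℝ, 0 ≤ c → algebraMap ℝ A c ∈ T)
    (harch : ∀ f, ∃ N : ℝ, algebraMap ℝ A N - f ∈ T)
    {L : A → ℝ} (hL : L ∈ (stateSet T).extremePoints ℝ) (a f : A) :
    L (a * f) = L a * L f := by
  have hLs := hL.1
  have hpos : ∀ a ∈ T, L (a * f) = L a * L f := by
    intro a ha
    obtain ⟨N, hN⟩ := harch a
    set M : ℝ := |N| + 1
    have hM : 0 < M := by positivity
    have h1 : M⁻¹ • a ∈ T := by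
      rw [Algebra.smul_def]; exact T.mul_mem (hT _ (by positivity)) ha
    have h2 : 1 - M⁻¹ • a ∈ T := by
      have h3 : (1 : A) - M⁻¹ • a
          = algebraMap ℝ A M⁻¹ * (algebraMap ℝ A N - a + algebraMap ℝ A (M - N)) := by
        rw [map_sub, Algebra.smul_def]
        have : algebraMap ℝ A M⁻¹ * algebraMap ℝ A M = 1 := by
          rw [← map_mul, inv_mul_cancel₀ hM.ne', map_one]
        linear_combination -this
      rw [h3]
      refine T.mul_mem (hT _ (by positivity)) (T.add_mem hN (hT _ ?_))
      have := le_abs_self N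
      simp only [M]; linarith
    have h4 := map_mul_of_extreme_of_le_one harch hL h1 h2 f
    rw [smul_mul_assoc, hLs.2.1, hLs.2.1, mul_assoc] at h4
    exact mul_left_cancel₀ (inv_ne_zero hM.ne') h4
  obtain ⟨N, hN⟩ := harch a
  have h1 := hpos _ hN
  rw [sub_mul, stateSet_sub hLs, stateSet_sub hLs, stateSet_algebraMap hLs, ← Algebra.smul_def,
    hLs.2.1] at h1
  linarith

/-- The representation theorem of Krivine, Kadison and Dubois for archimedean semirings. -/
theorem mem_of_forall_character_pos (hT : ∀ c : ℝ, 0 ≤ c → algebraMap ℝ A c ∈ T)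
    (harch : ∀ f, ∃ N : ℝ, algebraMap ℝ A N - f ∈ T) {q : A}
    (hq : ∀ φ : A →ₐ[ℝ] ℝ, (∀ t ∈ T, 0 ≤ φ t) → 0 < φ q) : q ∈ T := by
  by_contra hqT
  obtain ⟨L₀, hL₀, hL₀q⟩ := exists_state_nonpos hT harch hqT
  have hcomp := isCompact_stateSet harch
  -- The states minimizing the value at `q` form a compact exposed face; by Krein–Milman it has an
  -- extreme point, which is also extreme among all states.
  let l : StrongDual ℝ (A → ℝ) := -ContinuousLinearMap.proj q
  have hexp : IsExposed ℝ (stateSet T) (l.toExposed (stateSet T)) :=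
    ContinuousLinearMap.toExposed.isExposed
  have hne : (l.toExposed (stateSet T)).Nonempty := by
    obtain ⟨L, hL, hmax⟩ := hcomp.exists_isMaxOn ⟨L₀, hL₀⟩ l.continuous.continuousOn
    exact ⟨L, hL, hmax⟩
  obtain ⟨L, hL⟩ := (hexp.isCompact hcomp).extremePoints_nonempty hne
  have hle : L q ≤ 0 := by
    have : -(L₀ q) ≤ -(L q) := hL.1.2 L₀ hL₀
    linarith
  have hLext := hexp.isExtreme.extremePoints_subset_extremePoints hL
  have hLs := hLext.1
  let lin : A →ₗ[ℝ] ℝ := { toFun := L, map_add' := hLs.1, map_smul' := hLs.2.1 }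
  let φ : A →ₐ[ℝ] ℝ := AlgHom.ofLinearMap lin hLs.2.2.2 (map_mul_of_extreme hT harch hLext)
  exact absurd (hq φ hLs.2.2.1) (not_lt.2 hle)

end Representation

/-! ### Damping the constraints on a compact set -/

section Penalty

/-- The multiplier `(1 - t / U) ^ (2 k)` damps `t` for `t ≥ 0` and amplifies it for `t ≤ 0`. -/
theorem damped_le {U t : ℝ} (hU : 0 < U) (ht : t ≤ U) (k : ℕ) (hk : 0 < k) :
    ((U - t) / U) ^ (2 * k) * t ≤ U / k - k * ((min t 0) ^ 2 / U) := by
  have hk' : (0 : ℝ) < k := by exact_mod_cast hk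
  obtain ⟨s, rfl⟩ : ∃ s, t = U * s := ⟨t / U, by field_simp⟩
  have e : (U - U * s) / U = 1 - s := by field_simp
  have hs : s ≤ 1 := by nlinarith
  rw [e]
  rcases le_total 0 s with h0 | h0
  · rw [min_eq_right (by positivity)]
    -- Bernoulli gives `(1 - s) ^ k * (1 + k * s) ≤ (1 - s ^ 2) ^ k ≤ 1`.
    have h1 : 1 + (k : ℝ) * s ≤ (1 + s) ^ k := one_add_mul_le_pow (by linarith) k
    have h2 : (1 + s) ^ k * (1 - s) ^ k ≤ 1 := by
      rw [← mul_pow]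
      exact pow_le_one₀ (by nlinarith) (by nlinarith)
    have h3 : 0 ≤ (1 - s) ^ k := pow_nonneg (by linarith) k
    have h4 : (1 - s) ^ k ≤ 1 := pow_le_one₀ (by linarith) (by linarith)
    have h5 : (1 - s) ^ (2 * k) ≤ (1 - s) ^ k :=
      pow_le_pow_of_le_one (by linarith) (by linarith) (by lia)
    have h6 : (1 - s) ^ k * (k * s) ≤ 1 := by nlinarith
    have h7 : (1 - s) ^ k * s ≤ 1 / k := by
      rw [le_div_iff₀ hk']; linarith
    have h8 : (1 - s) ^ (2 * k) * s ≤ 1 / k :=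
      (mul_le_mul_of_nonneg_right h5 h0).trans h7
    have h9 := mul_le_mul_of_nonneg_left h8 hU.le
    calc _ = U * ((1 - s) ^ (2 * k) * s) := by ring
      _ ≤ U * (1 / k) := h9
      _ = _ := by ring
  · rw [min_eq_left (by nlinarith)]
    have h1 : 1 + ((2 * k : ℕ) : ℝ) * (-s) ≤ (1 + -s) ^ (2 * k) :=
      one_add_mul_le_pow (by linarith) _
    push_cast at h1
    have h2 : (1 - s) ^ (2 * k) * s ≤ - (k * s ^ 2) := by
      rw [sub_eq_add_neg]
      nlinarith [mul_le_mul_of_nonpos_right h1 h0, mul_nonneg hk'.le (sq_nonneg s)]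
    have h9 := mul_le_mul_of_nonneg_left h2 hU.le
    have h10 : 0 < U / k := by positivity
    calc _ = U * ((1 - s) ^ (2 * k) * s) := by ring
      _ ≤ U * -(k * s ^ 2) := h9
      _ = -(k * ((U * s) ^ 2 / U)) := by field_simp
      _ ≤ _ := by linarith

/-- A function that is positive where the penalty `h` vanishes stays positive on a compact set
after adding a large multiple of `h`. -/
theorem exists_penalty {X : Type*} [TopologicalSpace X] {B : Set X} (hB : IsCompact B)
    {p h : X → ℝ} (hp : Continuous p) (hh : Continuous h) (hh0 : ∀ x, 0 ≤ h x) (c : ℝ)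
    (hc : 0 ≤ c) (hpos : ∀ x ∈ B, h x = 0 → 0 < p x) :
    ∃ k : ℕ, 0 < k ∧ ∀ x ∈ B, 0 < p x + k * h x - c / k := by
  -- Monotonicity in the index lets one member of the open cover suffice; the shift by one avoids
  -- division by zero.
  have hmono : ∀ i j : ℕ, i ≤ j → ∀ x,
      p x + (i + 1 : ℕ) * h x - c / (i + 1 : ℕ) ≤ p x + (j + 1 : ℕ) * h x - c / (j + 1 : ℕ) := by
    intro i j hij x
    have h1 : ((i + 1 : ℕ) : ℝ) ≤ (j + 1 : ℕ) := by exact_mod_cast Nat.succ_le_succ hij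
    have h2 := mul_le_mul_of_nonneg_right h1 (hh0 x)
    have h3 : c / (j + 1 : ℕ) ≤ c / (i + 1 : ℕ) :=
      div_le_div_of_nonneg_left hc (by positivity) h1
    linarith
  obtain ⟨k, hk⟩ := hB.elim_directed_cover
    (fun k : ℕ => {x | 0 < p x + (k + 1 : ℕ) * h x - c / (k + 1 : ℕ)})
    (fun k => isOpen_lt continuous_const (by fun_prop))
    (by
      intro x hx
      rw [Set.mem_iUnion]
      have hlim : Filter.Tendsto (fun k : ℕ => c / ((k + 1 : ℕ) : ℝ)) Filter.atTop (nhds 0) :=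
        (tendsto_const_div_atTop_nhds_zero_nat c).comp (Filter.tendsto_add_atTop_nat 1)
      rcases (hh0 x).eq_or_lt with h0 | h0
      · obtain ⟨k, hk⟩ := (hlim.eventually_lt_const (hpos x hx h0.symm)).exists
        refine ⟨k, ?_⟩
        change 0 < p x + ((k + 1 : ℕ) : ℝ) * h x - c / ((k + 1 : ℕ) : ℝ)
        rw [← h0]
        linarith
      · obtain ⟨k, hk⟩ := exists_nat_gt ((c - p x) / h x)
        refine ⟨k, ?_⟩
        change 0 < p x + ((k + 1 : ℕ) : ℝ) * h x - c / ((k + 1 : ℕ) : ℝ)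
        rw [div_lt_iff₀ h0] at hk
        have h1 : c / (k + 1 : ℕ) ≤ c := div_le_self hc (by simp)
        push_cast at h1 ⊢
        linarith)
    (directed_of_isDirected_le fun i j hij x hx => lt_of_lt_of_le hx (hmono i j hij x))
  exact ⟨k + 1, k.succ_pos, fun x hx => hk hx⟩

/-- Subtracting suitably damped multiples of the constraints turns positivity on the feasible part
of a compact set into positivity on the whole compact set. -/
theorem exists_damped_pos {X ι : Type*} [TopologicalSpace X] [Fintype ι] {B : Set X}
    (hB : IsCompact B) {p : X → ℝ} (hp : Continuous p) {g : ι → X → ℝ}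
    (hg : ∀ j, Continuous (g j)) {U : ι → ℝ} (hU : ∀ j, 0 < U j)
    (hgU : ∀ j, ∀ x ∈ B, g j x ≤ U j) (hpos : ∀ x ∈ B, (∀ j, 0 ≤ g j x) → 0 < p x) :
    ∃ k : ℕ, ∀ x ∈ B, 0 < p x - ∑ j, ((U j - g j x) / U j) ^ (2 * k) * g j x := by
  have hterm : ∀ j x, 0 ≤ (min (g j x) 0) ^ 2 / U j := fun j x =>
    div_nonneg (sq_nonneg _) (hU j).le
  obtain ⟨k, hk, hk'⟩ := exists_penalty hB hp
    (h := fun x => ∑ j, (min (g j x) 0) ^ 2 / U j) (by fun_prop)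
    (fun x => Finset.sum_nonneg fun j _ => hterm j x) (∑ j, U j)
    (Finset.sum_nonneg fun j _ => (hU j).le)
    (by
      intro x hx h0
      refine hpos x hx fun j => ?_
      have := (Finset.sum_eq_zero_iff_of_nonneg fun j _ => hterm j x).1 h0 j (Finset.mem_univ j)
      have h1 : min (g j x) 0 = 0 := by simpa [(hU j).ne'] using this
      exact min_eq_right_iff.1 h1)
  refine ⟨k, fun x hx => (hk' x hx).trans_le ?_⟩
  have := Finset.sum_le_sum fun j (_ : j ∈ Finset.univ) => damped_le (hU j) (hgU j x hx) k hk
  rw [Finset.sum_sub_distrib, ← Finset.mul_sum, ← Finset.sum_div] at this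
  linarith

end Penalty

/-! ### Even monomials and the four classes -/

section EvenMonomials

variable {σ : Type}

theorem IsSumOf.of_mem {P : MvPolynomial σ ℝ → Prop} {p : MvPolynomial σ ℝ} (hp : P p) :
    IsSumOf P p :=
  ⟨1, fun _ => p, fun _ => hp, by simp⟩

theorem IsSumOf.zero (P : MvPolynomial σ ℝ → Prop) : IsSumOf P 0 :=
  ⟨0, fun _ => 0, fun l => l.elim0, by simp⟩

theorem IsSumOf.add {P : MvPolynomial σ ℝ → Prop} {p q : MvPolynomial σ ℝ}
    (hp : IsSumOf P p) (hq : IsSumOf P q) : IsSumOf P (p + q) := by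
  obtain ⟨s, f, hf, rfl⟩ := hp
  obtain ⟨t, g, hg, rfl⟩ := hq
  refine ⟨s + t, Fin.append f g, fun l => ?_, ?_⟩
  · refine Fin.addCases (fun i => ?_) (fun i => ?_) l
    · rw [Fin.append_left]; exact hf i
    · rw [Fin.append_right]; exact hg i
  · rw [Fin.sum_univ_add]
    simp only [Fin.append_left, Fin.append_right]

variable (σ) in
/-- The monomials with even exponents and positive coefficients. -/
noncomputable def evenMonomials : Submonoid (MvPolynomial σ ℝ) where
  carrier := {q | ∃ (α : σ →₀ ℕ) (c : ℝ), 0 < c ∧ q = monomial (α + α) c}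
  one_mem' := ⟨0, 1, one_pos, by simp⟩
  mul_mem' := by
    rintro _ _ ⟨α, c, hc, rfl⟩ ⟨β, d, hd, rfl⟩
    exact ⟨α + β, c * d, mul_pos hc hd, by rw [monomial_mul, add_add_add_comm]⟩

variable (σ) in
/-- The polynomials with non-negative coefficients and only even exponents. -/
noncomputable def evenSemiring : Subsemiring (MvPolynomial σ ℝ) := (evenMonomials σ).subsemiringClosure

theorem monomial_mem_evenSemiring (α : σ →₀ ℕ) {c : ℝ} (hc : 0 ≤ c) :
    monomial (α + α) c ∈ evenSemiring σ := by
  rcases hc.eq_or_lt with rfl | hc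
  · rw [monomial_zero]; exact zero_mem _
  · exact AddSubmonoid.subset_closure ⟨α, c, hc, rfl⟩

theorem C_mem_evenSemiring {c : ℝ} (hc : 0 ≤ c) : C c ∈ evenSemiring σ := by
  simpa using monomial_mem_evenSemiring (0 : σ →₀ ℕ) hc

theorem X_sq_mem_evenSemiring (i : σ) : (X i ^ 2 : MvPolynomial σ ℝ) ∈ evenSemiring σ := by
  have := monomial_mem_evenSemiring (Finsupp.single i 1) (zero_le_one (α := ℝ))
  rwa [← Finsupp.single_add, ← X_pow_eq_monomial] at this

/-- The semiring is the additive closure of a multiplicative monoid, so only its monomials need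
checking. The map `f` allows for multiplication by a variable. -/
theorem isSumOf_of_mem_evenSemiring {τ : Type} {P : MvPolynomial τ ℝ → Prop}
    (f : MvPolynomial σ ℝ →+ MvPolynomial τ ℝ)
    (hP : ∀ (α : σ →₀ ℕ) (c : ℝ), 0 < c → P (f (monomial (α + α) c)))
    {p : MvPolynomial σ ℝ} (hp : p ∈ evenSemiring σ) : IsSumOf P (f p) := by
  change p ∈ AddSubmonoid.closure (evenMonomials σ : Set (MvPolynomial σ ℝ)) at hp
  induction hp using AddSubmonoid.closure_induction with
  | mem q hq => obtain ⟨α, c, hc, rfl⟩ := hq; exact .of_mem (hP α c hc)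
  | zero => rw [map_zero]; exact .zero P
  | add q q' _ _ h h' => rw [map_add]; exact h.add h'

theorem evenSemiring_subset_KDSOS : (evenSemiring σ : Set (MvPolynomial σ ℝ)) ⊆ KDSOS σ :=
  fun _ hp => isSumOf_of_mem_evenSemiring
    (P := fun q => ∃ (a b : ℝ) (α β : σ →₀ ℕ),
      (a = b ∨ a = -b) ∧ q = (monomial α a + monomial β b) ^ 2) (AddMonoidHom.id _)
    (fun α c hc => ⟨√c / 2, √c / 2, α, α, Or.inl rfl, by
      rw [← map_add, add_halves, sq, monomial_mul, Real.mul_self_sqrt hc.le]; rfl⟩) hp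

theorem KDSOS_subset_KSDSOS : KDSOS σ ⊆ KSDSOS σ := by
  rintro p ⟨s, q, hq, rfl⟩
  exact ⟨s, q, fun l => by obtain ⟨a, b, α, β, -, h⟩ := hq l; exact ⟨a, b, α, β, h⟩, rfl⟩

theorem isCircuitPolynomial_monomial (α : σ →₀ ℕ) {c : ℝ} (hc : 0 < c) :
    IsCircuitPolynomial (monomial (α + α) c) := by
  refine ⟨{α + α}, fun _ => c, 0, α + α, ?_, fun _ _ => hc, ?_, ?_, by simp⟩
  · intro β hβ i
    rw [Finset.mem_singleton.1 hβ]
    exact ⟨α i, rfl⟩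
  · have : Subsingleton ({α + α} : Finset (σ →₀ ℕ)) := by
      rw [← Finset.coe_sort_coe, Set.subsingleton_coe]; simp
    exact affineIndependent_of_subsingleton ℝ _
  · simp [intrinsicInterior_singleton]

theorem eval_monomial_even_nonneg (α : σ →₀ ℕ) {c : ℝ} (hc : 0 ≤ c) (x : σ → ℝ) :
    0 ≤ eval x (monomial (α + α) c) := by
  rw [eval_monomial, Finsupp.prod_add_index' (by simp) (by intros; rw [pow_add])]
  exact mul_nonneg hc (mul_self_nonneg _)

theorem evenSemiring_subset_KSONC : (evenSemiring σ : Set (MvPolynomial σ ℝ)) ⊆ KSONC σ :=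
  fun _ hp => isSumOf_of_mem_evenSemiring
    (P := fun q => IsCircuitPolynomial q ∧ ∀ x : σ → ℝ, 0 ≤ eval x q) (AddMonoidHom.id _)
    (fun α _ hc => ⟨isCircuitPolynomial_monomial α hc, eval_monomial_even_nonneg α hc.le⟩) hp

theorem isAGE_monomial (α : σ →₀ ℕ) {c : ℝ} (hc : 0 ≤ c) : IsAGE (monomial α c) := by
  classical
  constructor
  · intro x hx
    rw [eval_monomial]
    exact mul_nonneg hc (Finset.prod_nonneg fun i _ => pow_nonneg (hx i) _)
  · intro β hβ
    change coeff β (monomial α c) < 0 at hβ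
    rw [coeff_monomial] at hβ
    split_ifs at hβ <;> linarith

theorem evenSemiring_subset_KSAGE : (evenSemiring σ : Set (MvPolynomial σ ℝ)) ⊆ KSAGE σ :=
  fun _ hp => isSumOf_of_mem_evenSemiring (P := IsAGE) (AddMonoidHom.id _)
    (fun _ _ hc => isAGE_monomial _ hc.le) hp

/-- The odd exponent is harmless because AGE polynomials need non-negativity only on the orthant. -/
theorem mul_X_mem_KSAGE {p : MvPolynomial σ ℝ} (hp : p ∈ evenSemiring σ) (i : σ) :
    p * X i ∈ KSAGE σ :=
  isSumOf_of_mem_evenSemiring (AddMonoidHom.mulRight (X i)) (fun α c hc => by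
    rw [AddMonoidHom.mulRight_apply, X, monomial_mul, mul_one]
    exact isAGE_monomial _ hc.le) hp

end EvenMonomials

/-! ### The archimedean semiring of the ball -/

section Ball

variable {n : ℕ} (r : ℝ)

@[simp] theorem substBall_add (α β : MvPolynomial (YZU n) ℝ) :
    substBall r (α + β) = substBall r α + substBall r β := map_add _ _ _

@[simp] theorem substBall_mul (α β : MvPolynomial (YZU n) ℝ) :
    substBall r (α * β) = substBall r α * substBall r β := map_mul _ _ _

@[simp] theorem substBall_pow (α : MvPolynomial (YZU n) ℝ) (k : ℕ) :
    substBall r (α ^ k) = substBall r α ^ k := map_pow _ _ _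

@[simp] theorem substBall_zero : substBall (n := n) r 0 = 0 := map_zero _

@[simp] theorem substBall_one : substBall (n := n) r 1 = 1 := map_one _

@[simp] theorem substBall_C (c : ℝ) : substBall (n := n) r (C c) = C c := aeval_C _ _

@[simp] theorem substBall_X_inl (i : Fin n) :
    substBall r (X (Sum.inl i)) = X i + C r := by simp [substBall]

@[simp] theorem substBall_X_inr_inl (i : Fin n) :
    substBall r (X (Sum.inr (Sum.inl i))) = C r - X i := by simp [substBall]

@[simp] theorem substBall_X_inr_inr :
    substBall r (X (Sum.inr (Sum.inr ()))) = ballPoly n r := by simp [substBall]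

variable (n) in
/-- The semiring generated by the non-negative constants, the squares of `x_i + r` and of `r - x_i`,
and `r² - ‖x‖²`. -/
noncomputable def ballSemiring : Subsemiring (MvPolynomial (Fin n) ℝ) where
  carrier := {f | ∃ α ∈ evenSemiring (YZU n), ∃ β ∈ evenSemiring (YZU n),
    f = substBall r α + substBall r β * ballPoly n r}
  zero_mem' := ⟨0, zero_mem _, 0, zero_mem _, by simp⟩
  one_mem' := ⟨1, one_mem _, 0, zero_mem _, by simp⟩
  add_mem' := by
    rintro _ _ ⟨α, hα, β, hβ, rfl⟩ ⟨α', hα', β', hβ', rfl⟩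
    exact ⟨α + α', add_mem hα hα', β + β', add_mem hβ hβ', by simp only [substBall_add]; ring⟩
  mul_mem' := by
    rintro _ _ ⟨α, hα, β, hβ, rfl⟩ ⟨α', hα', β', hβ', rfl⟩
    -- The square of `r² - ‖x‖²` is absorbed as the even monomial `u²`.
    refine ⟨α * α' + β * β' * X (Sum.inr (Sum.inr ())) ^ 2,
      add_mem (mul_mem hα hα') (mul_mem (mul_mem hβ hβ') (X_sq_mem_evenSemiring _)),
      α * β' + β * α', add_mem (mul_mem hα hβ') (mul_mem hβ hα'), ?_⟩
    simp only [substBall_add, substBall_mul, substBall_pow, substBall_X_inr_inr]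
    ring

theorem substBall_mem_ballSemiring {α : MvPolynomial (YZU n) ℝ} (hα : α ∈ evenSemiring (YZU n)) :
    substBall r α ∈ ballSemiring n r :=
  ⟨α, hα, 0, zero_mem _, by simp⟩

theorem C_mem_ballSemiring {c : ℝ} (hc : 0 ≤ c) : C c ∈ ballSemiring n r := by
  simpa using substBall_mem_ballSemiring (n := n) r (C_mem_evenSemiring hc)

theorem ballPoly_mem_ballSemiring : ballPoly n r ∈ ballSemiring n r :=
  ⟨0, zero_mem _, 1, one_mem _, by simp⟩

theorem add_sq_mem_ballSemiring (i : Fin n) : (X i + C r) ^ 2 ∈ ballSemiring n r := by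
  simpa using substBall_mem_ballSemiring (n := n) r (X_sq_mem_evenSemiring (Sum.inl i))

theorem sub_sq_mem_ballSemiring (i : Fin n) : (C r - X i) ^ 2 ∈ ballSemiring n r := by
  simpa using substBall_mem_ballSemiring (n := n) r (X_sq_mem_evenSemiring (Sum.inr (Sum.inl i)))

theorem sum_sq_add_ballPoly :
    ∑ i : Fin n, ((X i + C r) ^ 2 + (C r - X i) ^ 2) + 2 * ballPoly n r
      = C (2 * r ^ 2 * (n + 1)) := by
  have h : ∀ i : Fin n, (X i + C r) ^ 2 + (C r - X i) ^ 2
      = 2 * X i ^ 2 + (2 * C (r ^ 2) : MvPolynomial (Fin n) ℝ) := fun i => by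
    rw [C_pow]; ring
  simp only [h, Finset.sum_add_distrib, ← Finset.mul_sum, Finset.sum_const, Finset.card_univ,
    Fintype.card_fin, ballPoly, nsmul_eq_mul]
  simp only [map_mul, map_add, map_natCast, map_ofNat, map_one, map_pow]
  ring

/-- Since `4 r x_i = (x_i + r)² - (r - x_i)²`, adding it to the constant of `sum_sq_add_ballPoly`,
or subtracting it, replaces one of the two squares by the other. -/
theorem four_mul_X_bounded (i : Fin n) :
    C (2 * r ^ 2 * (n + 1)) + C (4 * r) * X i ∈ ballSemiring n r ∧
      C (2 * r ^ 2 * (n + 1)) - C (4 * r) * X i ∈ ballSemiring n r := by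
  have hrest : ∑ j ∈ Finset.univ.erase i, ((X j + C r) ^ 2 + (C r - X j) ^ 2) + 2 * ballPoly n r
      ∈ ballSemiring n r := by
    refine add_mem (sum_mem fun j _ => add_mem (add_sq_mem_ballSemiring r j)
      (sub_sq_mem_ballSemiring r j)) ?_
    rw [two_mul]
    exact add_mem (ballPoly_mem_ballSemiring r) (ballPoly_mem_ballSemiring r)
  have hy := add_sq_mem_ballSemiring r i
  have hz := sub_sq_mem_ballSemiring r i
  have key := sum_sq_add_ballPoly (n := n) r
  rw [← Finset.add_sum_erase _ _ (Finset.mem_univ i)] at key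
  constructor
  · convert add_mem (add_mem hy hy) hrest using 1
    rw [← key, map_mul, map_ofNat]; ring
  · convert add_mem (add_mem hz hz) hrest using 1
    rw [← key, map_mul, map_ofNat]; ring

theorem exists_bound_ballSemiring {r : ℝ} (hr : 0 < r) (f : MvPolynomial (Fin n) ℝ) :
    ∃ N : ℝ, C N + f ∈ ballSemiring n r ∧ C N - f ∈ ballSemiring n r := by
  have hmul : ∀ f g : MvPolynomial (Fin n) ℝ,
      (∃ N : ℝ, C N + f ∈ ballSemiring n r ∧ C N - f ∈ ballSemiring n r) →
      (∃ N : ℝ, C N + g ∈ ballSemiring n r ∧ C N - g ∈ ballSemiring n r) →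
      ∃ N : ℝ, C N + f * g ∈ ballSemiring n r ∧ C N - f * g ∈ ballSemiring n r := by
    rintro f g ⟨N, h1, h2⟩ ⟨M, h3, h4⟩
    have hhalf : C (1 / 2 : ℝ) ∈ ballSemiring n r := C_mem_ballSemiring r (by norm_num)
    have hC : C (1 / 2 : ℝ) * 2 = (1 : MvPolynomial (Fin n) ℝ) := by
      rw [← map_ofNat C 2, ← map_mul]; norm_num
    -- `N M + f g` is half of `(N + f)(M + g) + (N - f)(M - g)`; for `N M - f g` the signs of `g`
    -- are switched.
    refine ⟨N * M, ?_, ?_⟩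
    · convert mul_mem hhalf (add_mem (mul_mem h1 h3) (mul_mem h2 h4)) using 1
      rw [map_mul]
      linear_combination -(C N * C M + f * g) * hC
    · convert mul_mem hhalf (add_mem (mul_mem h1 h4) (mul_mem h2 h3)) using 1
      rw [map_mul]
      linear_combination -(C N * C M - f * g) * hC
  have hconst : ∀ a : ℝ, ∃ N : ℝ, C N + C a ∈ ballSemiring n r ∧ C N - C a ∈ ballSemiring n r := by
    intro a
    refine ⟨|a|, ?_, ?_⟩
    · rw [← map_add]; exact C_mem_ballSemiring r (by linarith [neg_abs_le a])
    · rw [← map_sub]; exact C_mem_ballSemiring r (by linarith [le_abs_self a])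
  induction f using MvPolynomial.induction_on with
  | C a => exact hconst a
  | add f g hf hg =>
    obtain ⟨N, h1, h2⟩ := hf
    obtain ⟨M, h3, h4⟩ := hg
    refine ⟨N + M, ?_, ?_⟩
    · convert add_mem h1 h3 using 1; rw [map_add]; ring
    · convert add_mem h2 h4 using 1; rw [map_add]; ring
  | mul_X f i hf =>
    refine hmul f (X i) hf ?_
    have h := hmul (C (4 * r)⁻¹) _ (hconst _) ⟨_, four_mul_X_bounded r i⟩
    rwa [← mul_assoc, ← map_mul, inv_mul_cancel₀ (by positivity), map_one, one_mul] at h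

theorem eval_ballPoly (x : Fin n → ℝ) : eval x (ballPoly n r) = r ^ 2 - ∑ i, x i ^ 2 := by
  simp [ballPoly]

/-- A polynomial that is positive on the ball lies in the semiring `ballSemiring`. -/
theorem mem_ballSemiring_of_pos {r : ℝ} (hr : 0 < r) {q : MvPolynomial (Fin n) ℝ}
    (hq : ∀ x ∈ Metric.closedBall (0 : EuclideanSpace ℝ (Fin n)) r, 0 < eval x.ofLp q) :
    q ∈ ballSemiring n r := by
  refine mem_of_forall_character_pos (fun c hc => C_mem_ballSemiring r hc)
    (fun f => (exists_bound_ballSemiring hr f).imp fun _ h => h.2) fun φ hφ => ?_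
  -- A character is evaluation at the point `(φ (X i))`, and `φ (ballPoly n r) ≥ 0` places that
  -- point in the ball.
  have hφe : ∀ f, φ f = eval (fun i => φ (X i)) f := fun f => by
    conv_lhs => rw [aeval_unique φ]
    rw [aeval_eq_eval]; rfl
  have hb := hφ _ (ballPoly_mem_ballSemiring r)
  rw [hφe, eval_ballPoly] at hb
  have := hq (WithLp.toLp 2 fun i => φ (X i)) (by
    rw [mem_closedBall_zero_iff, EuclideanSpace.norm_eq, Real.sqrt_le_left hr.le]
    simp only [Real.norm_eq_abs, sq_abs]
    linarith)
  rw [hφe]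
  exact this

end Ball

/-! ### Assembly of both representations -/

theorem corollary4p1 (n m : ℕ) (g : Fin m → MvPolynomial (Fin n) ℝ) (r : ℝ) (hr : 0 < r)
    (U : Fin m → ℝ) (hUpos : ∀ j, 0 < U j)
    (hU : ∀ j, ∀ x ∈ Metric.closedBall (0 : EuclideanSpace ℝ (Fin n)) r, eval x.ofLp (g j) ≤ U j)
    (p : MvPolynomial (Fin n) ℝ)
    (hp : ∀ x ∈ Metric.closedBall (0 : EuclideanSpace ℝ (Fin n)) r,
      (∀ j, 0 ≤ eval x.ofLp (g j)) → 0 < eval x.ofLp p) :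
    (∀ K : (σ : Type) → Set (MvPolynomial σ ℝ),
      K = KSONC ∨ K = KSDSOS ∨ K = KDSOS ∨ K = KSAGE →
      ∃ α₀ ∈ K (YZU n), ∃ α₁ ∈ K (YZU n), ∃ ρ : Fin m → MvPolynomial Unit ℝ,
        (∀ j, ρ j ∈ K Unit) ∧
        p = substBall r α₀ + substBall r α₁ * ballPoly n r
          + ∑ j, substUniv (C (U j) - g j) (ρ j) * g j) ∧
    (∃ α ∈ KSAGE (YZU n), ∃ ρ : Fin m → MvPolynomial Unit ℝ,
      (∀ j, ρ j ∈ KSAGE Unit) ∧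
      p = substBall r α + ∑ j, substUniv (C (U j) - g j) (ρ j) * g j) := by
  have hcont : ∀ f : MvPolynomial (Fin n) ℝ,
      Continuous fun x : EuclideanSpace ℝ (Fin n) => eval x.ofLp f := fun f =>
    (MvPolynomial.continuous_eval f).comp (PiLp.continuous_ofLp 2 _)
  obtain ⟨k, hk⟩ := exists_damped_pos (isCompact_closedBall (0 : EuclideanSpace ℝ (Fin n)) r)
    (hcont p) (fun j => hcont (g j)) hUpos hU hp
  set ρ : Fin m → MvPolynomial Unit ℝ := fun j => (C (U j)⁻¹ * X ()) ^ (2 * k) with hρ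
  have hρmem : ∀ j, ρ j ∈ evenSemiring Unit := fun j => by
    simp only [hρ]
    rw [pow_mul, mul_pow, ← C_pow]
    exact pow_mem (mul_mem (C_mem_evenSemiring (sq_nonneg _)) (X_sq_mem_evenSemiring _)) k
  obtain ⟨α, hα, β, hβ, h⟩ := mem_ballSemiring_of_pos hr
    (q := p - ∑ j, substUniv (C (U j) - g j) (ρ j) * g j) (by
      intro x hx
      convert hk x hx using 1
      simp [substUniv, hρ, div_eq_inv_mul])
  rw [sub_eq_iff_eq_add] at h
  constructor
  · intro K hK
    have hsub : ∀ σ : Type, (evenSemiring σ : Set (MvPolynomial σ ℝ)) ⊆ K σ := by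
      intro σ
      rcases hK with rfl | rfl | rfl | rfl
      · exact evenSemiring_subset_KSONC
      · exact evenSemiring_subset_KDSOS.trans KDSOS_subset_KSDSOS
      · exact evenSemiring_subset_KDSOS
      · exact evenSemiring_subset_KSAGE
    exact ⟨α, hsub _ hα, β, hsub _ hβ, ρ, fun j => hsub _ (hρmem j), h⟩
  -- For SAGE the factor `r² - ‖x‖²` is absorbed as the variable `u`.
  · refine ⟨α + β * X (Sum.inr (Sum.inr ())),
      (evenSemiring_subset_KSAGE hα).add (mul_X_mem_KSAGE hβ _), ρ,
      fun j => evenSemiring_subset_KSAGE (hρmem j), ?_⟩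
    rw [substBall_add, substBall_mul, substBall_X_inr_inr]
    exact h
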